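/- Let $X$ be a real Banach space with closed unit ball $B_X$, and let $\mathcal{C}(X)$ be the space of all nonempty, closed, convex and bounded subsets of $X$, equipped with the Hausdorff distance \[ d_{\mathrm H}(C,D)=\inf\{\epsilon>0 : C\subseteq\mathrm{cl}(D+\epsilon B_X)\text{ and }D\subseteq\mathrm{cl}(C+\epsilon B_X)\}. \] For $C\in\mathcal{C}(X)$ and $\rho>0$ let $\mathrm{lr}(C,\rho)$ be the supremum (with $\sup\varnothing=0$) of all $r\ge 0$ such that for every finite set $F=\{x_1,\dots,x_n\}\subseteq rB_X$ and every $\epsilon>0$ there are a finite set $G=\{y_1,\dots,y_n\}\subseteq X$ and $z\in\rho B_X$ with $\|x_j-y_j\|<\epsilon$ for every $j$ and $z+G\subseteq C$. Let $\mathrm{blr}(C)=\sup_{\rho>0}\mathrm{lr}(C,\rho)$ be the bounded loose radius of $C$; these suprema are finite if $X\neq\{0\}$, and if $X=\{0\}$ we put $\mathrm{blr}(\{0\})=0$. A Borel set $E\subseteq X$ is Haar null if there is a Borel probability measure $\mu$ on $X$ such that $\mu(x+E)=0$ for every $x\in X$, and Haar positive if it is Borel and not Haar null. Theorem. The function $\mathrm{blr}:\mathcal{C}(X)\to\mathbb{R}$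 is $1$-Lipschitz. Moreover, if $X$ is separable, then the family of all Haar positive sets in $\mathcal{C}(X)$ is open in $\mathcal{C}(X)$; equivalently, if a sequence $(C_n)_{n\ge1}$ of Haar null sets in $\mathcal{C}(X)$ converges in $\mathcal{C}(X)$, then its limit is Haar null. -/

import Mathlib

open Set Filter Topology MeasureTheory
open scoped Pointwise

noncomputable section

/-- A subset `E` of an Abelian topological group `G` with its Borel `σ`-algebra is Haar null if it
is Borel and some Borel probability measure vanishes on all of its translates. -/
def IsHaarNull {G : Type*} [AddCommGroup G] [TopologicalSpace G] [MeasurableSpace G]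
    [BorelSpace G] (E : Set G) : Prop :=
  MeasurableSet E ∧ ∃ μ : Measure G, IsProbabilityMeasure μ ∧ ∀ x : G, μ (x +ᵥ E) = 0

/-- A Borel set is Haar positive if it is not Haar null. -/
def IsHaarPositive {G : Type*} [AddCommGroup G] [TopologicalSpace G] [MeasurableSpace G]
    [BorelSpace G] (E : Set G) : Prop :=
  MeasurableSet E ∧ ¬ IsHaarNull E

/-- The space `𝒞(X)` of all nonempty, closed, convex and bounded subsets of `X`. -/
@[ext]
structure ClosedConvexBounded (X : Type*) [NormedAddCommGroup X] [NormedSpace ℝ X] where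
  carrier : Set X
  nonempty : carrier.Nonempty
  isClosed : IsClosed carrier
  convex : Convex ℝ carrier
  isBounded : Bornology.IsBounded carrier

namespace ClosedConvexBounded

variable {X : Type*} [NormedAddCommGroup X] [NormedSpace ℝ X]

instance : CoeOut (ClosedConvexBounded X) (Set X) := ⟨carrier⟩

theorem hausdorffEDist_ne_top (C D : ClosedConvexBounded X) :
    Metric.hausdorffEDist (C : Set X) (D : Set X) ≠ ⊤ :=
  Metric.hausdorffEDist_ne_top_of_nonempty_of_bounded C.nonempty D.nonempty
    C.isBounded D.isBounded

/-- `𝒞(X)` is equipped with the Hausdorff distance. -/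
instance : MetricSpace (ClosedConvexBounded X) where
  dist C D := Metric.hausdorffDist (C : Set X) (D : Set X)
  dist_self _ := Metric.hausdorffDist_self_zero
  dist_comm _ _ := Metric.hausdorffDist_comm
  dist_triangle C D _ := Metric.hausdorffDist_triangle (hausdorffEDist_ne_top C D)
  eq_of_dist_eq_zero {C D} h := ClosedConvexBounded.ext
    ((C.isClosed.hausdorffDist_zero_iff_eq D.isClosed (hausdorffEDist_ne_top C D)).1 h)

/-- The Hausdorff distance is the infimum of all `ε > 0` such that `C ⊆ cl (D + ε B_X)` and
`D ⊆ cl (C + ε B_X)`. -/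
theorem dist_eq_sInf (C D : ClosedConvexBounded X) :
    dist C D = sInf {ε : ℝ | 0 < ε ∧
      (C : Set X) ⊆ closure ((D : Set X) + Metric.closedBall 0 ε) ∧
      (D : Set X) ⊆ closure ((C : Set X) + Metric.closedBall 0 ε)} := by
  have key : ∀ (A B : ClosedConvexBounded X) (ε : ℝ), dist A B < ε →
      (A : Set X) ⊆ closure ((B : Set X) + Metric.closedBall 0 ε) := by
    intro A B ε h x hx
    obtain ⟨y, hy, hxy⟩ :=
      Metric.exists_dist_lt_of_hausdorffDist_lt hx h (hausdorffEDist_ne_top A B)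
    refine subset_closure ⟨y, hy, x - y, ?_, by simp⟩
    simpa [← dist_eq_norm] using hxy.le
  have key2 : ∀ (A B : ClosedConvexBounded X) (ε δ : ℝ), 0 < δ →
      (A : Set X) ⊆ closure ((B : Set X) + Metric.closedBall 0 ε) →
      ∀ x ∈ (A : Set X), ∃ y ∈ (B : Set X), dist x y ≤ ε + δ := by
    intro A B ε δ hδ h x hx
    obtain ⟨w, ⟨y, hy, z, hz, rfl⟩, hw⟩ := Metric.mem_closure_iff.1 (h hx) δ hδ
    refine ⟨y, hy, ?_⟩
    have h1 := dist_triangle x (y + z) y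
    have h2 : dist (y + z) y ≤ ε := by simpa [dist_eq_norm] using hz
    simp only at hw
    linarith
  refine le_antisymm ?_ ?_
  · refine le_csInf ⟨dist C D + 1, by positivity, key C D _ (by linarith),
      key D C _ (by rw [dist_comm]; linarith)⟩ ?_
    rintro ε ⟨hε, h1, h2⟩
    refine le_of_forall_pos_le_add fun δ hδ => ?_
    exact Metric.hausdorffDist_le_of_mem_dist (by positivity)
      (key2 C D ε δ hδ h1) (key2 D C ε δ hδ h2)
  · refine le_of_forall_pos_le_add fun δ hδ => ?_
    refine csInf_le ⟨0, fun ε h => h.1.le⟩ ⟨by positivity, key C D _ (by linarith),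
      key D C _ (by rw [dist_comm]; linarith)⟩

end ClosedConvexBounded

section LooseRadius

variable {X : Type*} [NormedAddCommGroup X] [NormedSpace ℝ X]

/-- The radii `r ≥ 0` such that every finite family in `r B_X` can, after an arbitrarily small
perturbation, be translated into `C` by a vector of `ρ B_X`. -/
def looseRadii (C : Set X) (ρ : ℝ) : Set ℝ :=
  {r : ℝ | 0 ≤ r ∧ ∀ (n : ℕ) (x : Fin n → X), (∀ j, x j ∈ Metric.closedBall (0 : X) r) →
    ∀ ε : ℝ, 0 < ε → ∃ (y : Fin n → X) (z : X), z ∈ Metric.closedBall (0 : X) ρ ∧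
      (∀ j, ‖x j - y j‖ < ε) ∧ ∀ j, z + y j ∈ C}

/-- The `ρ`-loose radius `lr(C, ρ)`, with `sup ∅ = 0`. -/
def looseRadius (C : Set X) (ρ : ℝ) : ℝ := sSup (looseRadii C ρ)

/-- The bounded loose radius `blr(C) = sup_{ρ > 0} lr(C, ρ)`. -/
def boundedLooseRadius (C : Set X) : ℝ := ⨆ ρ : Ioi (0 : ℝ), looseRadius C ρ

/-- The diameter is an upper bound of the loose radii, so that the suprema above are genuine. -/
theorem le_diam_of_mem_looseRadii [Nontrivial X] {C : Set X} (hC : Bornology.IsBounded C)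
    {ρ r : ℝ} (hr : r ∈ looseRadii C ρ) : r ≤ Metric.diam C := by
  obtain ⟨h0, h⟩ := hr
  obtain ⟨v, hv⟩ := exists_norm_eq X h0
  refine le_of_forall_pos_le_add fun ε hε => ?_
  obtain ⟨y, z, -, hy, hyC⟩ := h 2 ![v, 0] (by intro j; fin_cases j <;> simp [hv, h0])
    (ε / 2) (by positivity)
  have h1 := Metric.dist_le_diam_of_mem hC (hyC 0) (hyC 1)
  have h2 := hy 0
  have h3 := hy 1
  simp only [Matrix.cons_val_zero, Matrix.cons_val_one, zero_sub, norm_neg] at h2 h3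
  rw [dist_add_left, dist_eq_norm] at h1
  have h4 : ‖v‖ ≤ ‖v - y 0‖ + ‖y 0 - y 1‖ + ‖y 1‖ := by
    calc ‖v‖ = ‖(v - y 0) + (y 0 - y 1) + y 1‖ := by congr 1; abel
      _ ≤ _ := norm_add₃_le
  linarith

theorem bddAbove_looseRadii [Nontrivial X] {C : Set X} (hC : Bornology.IsBounded C) (ρ : ℝ) :
    BddAbove (looseRadii C ρ) :=
  ⟨_, fun _ hr => le_diam_of_mem_looseRadii hC hr⟩

theorem bddAbove_range_looseRadius [Nontrivial X] {C : Set X} (hC : Bornology.IsBounded C) :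
    BddAbove (range fun ρ : Ioi (0 : ℝ) => looseRadius C ρ) := by
  refine ⟨Metric.diam C, ?_⟩
  rintro _ ⟨ρ, rfl⟩
  exact Real.sSup_le (fun r hr => le_diam_of_mem_looseRadii hC hr) Metric.diam_nonneg

end LooseRadius

end

/-! A closed convex bounded set in a separable Banach space is Haar positive exactly when it has a
positive loose radius, and loose radii are stable under Hausdorff perturbation.

Stability (`sub_mem_looseRadii`): if every point of `C` is within `δ` of the convex set `D`, a
radius `r ≥ δ` of `C` yields the radius `r - δ` of `D` with the same `ρ`. Moving points from `C` to
`D` costs an error `δ`, and Hahn–Banach in `Xⁿ` trades this error for radius. The Lipschitz bound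
follows on taking suprema.

Positive radius implies Haar positive: `C` contains a translate of every compact subset of `(r / 2)
B_X`, by successive halving of the remainder. Every Borel probability charges such a compact set up
to translation.

Conversely, if no radius is positive, a minimax argument (`half_mem_looseRadii`) gives arbitrarily
small finitely supported random vectors that hit each translate of some neighbourhood of `C` with
probability at most `3 / 4`. The law of a rapidly decreasing independent sum of them vanishes on all
translates of `C`. -/

open scoped ENNReal

/-! ### Stability of loose radii and the Lipschitz bound -/

section Transfer

variable {X : Type*} [NormedAddCommGroup X] [NormedSpace ℝ X]

theorem exists_norm_le_le_apply (f : X →L[ℝ] ℝ) {δ η : ℝ} (hδ : 0 ≤ δ) (hη : 0 < η) :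
    ∃ g : X, ‖g‖ ≤ δ ∧ δ * ‖f‖ - η ≤ f g := by
  obtain ⟨x, hx, hfx⟩ := f.exists_lt_apply_of_lt_opNorm
    (show ‖f‖ - η / (δ + 1) < ‖f‖ by linarith [show 0 < η / (δ + 1) by positivity])
  have hη' : δ * (η / (δ + 1)) ≤ η := by
    rw [mul_div_assoc', div_le_iff₀ (by positivity)]
    nlinarith
  have key : δ * ‖f‖ - η ≤ δ * |f x| := by
    rw [Real.norm_eq_abs] at hfx
    nlinarith
  rcases abs_cases (f x) with ⟨h, -⟩ | ⟨h, -⟩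
  · refine ⟨δ • x, ?_, by simpa [h] using key⟩
    rw [norm_smul, Real.norm_of_nonneg hδ]
    nlinarith
  · refine ⟨-(δ • x), ?_, by simpa [h] using key⟩
    rw [norm_neg, norm_smul, Real.norm_of_nonneg hδ]
    nlinarith

theorem sub_mem_looseRadii {C D : Set X} {ρ r δ : ℝ} (hD : Convex ℝ D) (hδ : 0 ≤ δ)
    (hCD : ∀ c ∈ C, ∃ d ∈ D, ‖c - d‖ ≤ δ) (hr : r ∈ looseRadii C ρ) (hδr : δ ≤ r) :
    r - δ ∈ looseRadii D ρ := by
  refine ⟨by linarith, fun n x hx ε hε => ?_⟩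
  -- The families that some vector of `ρ B_X` translates into `D`; the claim is that `x` lies in the
  -- closure of this convex set.
  let K : Set (Fin n → X) := {v | ∃ z ∈ Metric.closedBall (0 : X) ρ, ∀ j, z + v j ∈ D}
  have hK : Convex ℝ K := by
    rintro v ⟨z, hz, hv⟩ w ⟨z', hz', hw⟩ a b ha hb hab
    refine ⟨a • z + b • z', convex_closedBall _ _ hz hz' ha hb hab, fun j => ?_⟩
    convert hD (hv j) (hw j) ha hb hab using 1
    simp only [Pi.add_apply, Pi.smul_apply, smul_add]
    abel
  suffices hxK : x ∈ closure K by
    obtain ⟨y, ⟨z, hz, hy⟩, hxy⟩ := Metric.mem_closure_iff.1 hxK ε hε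
    refine ⟨y, z, hz, fun j => ?_, hy⟩
    rw [← dist_eq_norm]
    exact (dist_le_pi_dist x y j).trans_lt hxy
  by_contra hxK
  obtain ⟨f, u, hfu, hux⟩ := geometric_hahn_banach_closed_point hK.closure isClosed_closure hxK
  let φ : Fin n → X →L[ℝ] ℝ := fun j => f.comp (ContinuousLinearMap.single ℝ (fun _ => X) j)
  have hf : ∀ v, f v = ∑ j, φ j (v j) := fun v => by
    conv_lhs => rw [← Finset.univ_sum_single v]
    simp [φ]
  set η := f x - u with hη_def
  have hη : 0 < η := by linarith
  set S := ∑ j, ‖φ j‖ with hS_def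
  have hS : 0 ≤ S := Finset.sum_nonneg fun _ _ => norm_nonneg _
  -- Each `x j` is pushed by at most `δ` in a direction nearly norming `φ j`. The gain, about `δ *
  -- ‖φ j‖`, offsets the loss in passing from `C` to `D`; the remaining errors total less than `η`.
  choose g hg hφg using fun j => exists_norm_le_le_apply (φ j) hδ
    (show 0 < η / (2 * (n + 1)) by positivity)
  obtain ⟨y, z, hz, hxy, hy⟩ := hr.2 n (fun j => x j + g j) (fun j => by
    have h1 := hx j
    rw [mem_closedBall_zero_iff] at h1 ⊢
    linarith [norm_add_le (x j) (g j), hg j]) (η / (2 * (S + 1))) (by positivity)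
  choose d hdD hd using fun j => hCD _ (hy j)
  have hv := hfu (fun j => d j - z) (subset_closure ⟨z, hz, fun j => by simpa using hdD j⟩)
  have hdiff : f x - f (fun j => d j - z) ≤ ∑ j, (‖φ j‖ * (η / (2 * (S + 1))) +
      η / (2 * (n + 1))) := by
    rw [hf, hf, ← Finset.sum_sub_distrib]
    refine Finset.sum_le_sum fun j _ => ?_
    have e : φ j (x j) - φ j (d j - z) =
        φ j (x j + g j - y j) + φ j (z + y j - d j) - φ j (g j) := by
      rw [← map_sub, ← map_add, ← map_sub]
      congr 1
      abel
    have h1 := (le_abs_self _).trans ((φ j).le_opNorm_of_le (hxy j).le)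
    have h2 := (le_abs_self _).trans ((φ j).le_opNorm_of_le (hd j))
    have h3 := hφg j
    rw [e]
    linarith
  rw [Finset.sum_add_distrib, ← Finset.sum_mul, ← hS_def, Finset.sum_const, Finset.card_univ,
    Fintype.card_fin, nsmul_eq_mul] at hdiff
  have h1 : S * (η / (2 * (S + 1))) ≤ η / 2 := by
    rw [mul_div_assoc', div_le_div_iff₀ (by positivity) (by positivity)]
    nlinarith
  have h2 : (n : ℝ) * (η / (2 * (n + 1))) < η / 2 := by
    rw [mul_div_assoc', div_lt_div_iff₀ (by positivity) (by positivity)]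
    nlinarith
  linarith

theorem looseRadius_le_add {C D : Set X} [Nontrivial X] {ρ δ : ℝ} (hD : Convex ℝ D)
    (hDb : Bornology.IsBounded D) (hδ : 0 ≤ δ)
    (hCD : ∀ c ∈ C, ∃ d ∈ D, ‖c - d‖ ≤ δ) : looseRadius C ρ ≤ looseRadius D ρ + δ := by
  have h0 : 0 ≤ looseRadius D ρ := Real.sSup_nonneg fun r hr => hr.1
  refine Real.sSup_le (fun r hr => ?_) (by positivity)
  rcases le_total δ r with h | h
  · have := le_csSup (bddAbove_looseRadii hDb ρ) (sub_mem_looseRadii hD hδ hCD hr h)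
    unfold looseRadius
    linarith
  · linarith

namespace ClosedConvexBounded

theorem exists_norm_sub_le {C D : ClosedConvexBounded X} {δ : ℝ} (h : dist C D < δ) :
    ∀ c ∈ (C : Set X), ∃ d ∈ (D : Set X), ‖c - d‖ ≤ δ := by
  intro c hc
  obtain ⟨d, hd, hcd⟩ := Metric.exists_dist_lt_of_hausdorffDist_lt hc h (hausdorffEDist_ne_top C D)
  exact ⟨d, hd, by simpa [dist_eq_norm] using hcd.le⟩

instance [Subsingleton X] : Subsingleton (ClosedConvexBounded X) :=
  ⟨fun C D => ClosedConvexBounded.ext ((Subsingleton.eq_univ_of_nonempty C.nonempty).trans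
    (Subsingleton.eq_univ_of_nonempty D.nonempty).symm)⟩

theorem lipschitzWith_boundedLooseRadius :
    LipschitzWith 1 (fun C : ClosedConvexBounded X => boundedLooseRadius (C : Set X)) := by
  rcases subsingleton_or_nontrivial X with hX | hX
  · exact LipschitzWith.of_dist_le_mul fun C D => by simp [Subsingleton.elim C D]
  refine LipschitzWith.of_le_add fun C D => le_of_forall_gt_imp_ge_of_dense fun a ha => ?_
  have hδ : dist C D < a - boundedLooseRadius (D : Set X) := by linarith
  have : Nonempty (Ioi (0 : ℝ)) := ⟨⟨1, mem_Ioi.2 one_pos⟩⟩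
  refine ciSup_le fun ρ => ?_
  have h1 := looseRadius_le_add (ρ := ρ) D.convex D.isBounded (dist_nonneg.trans hδ.le)
    (exists_norm_sub_le hδ)
  have h2 : looseRadius (D : Set X) ρ ≤ boundedLooseRadius (D : Set X) :=
    le_ciSup (bddAbove_range_looseRadius D.isBounded) ρ
  linarith

end ClosedConvexBounded

end Transfer

/-! ### A positive loose radius implies Haar positivity -/

section Compact

variable {X : Type*} [NormedAddCommGroup X] [NormedSpace ℝ X]

/-- One step of the successive approximation. The centres of a finite cover by balls of radius `t *
r / 4`, rescaled by `t⁻¹`, are perturbed by less than `r / 4` and translated into `C`. Subtracting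
the perturbed centres leaves a remainder of size `t * r / 4 + t * r / 4`. -/
theorem exists_compact_remainder {C : Set X} {ρ r t : ℝ} (hr : r ∈ looseRadii C ρ) (hr0 : 0 < r)
    (ht : 0 < t) {K : Set X} (hK : IsCompact K) (hKr : K ⊆ Metric.closedBall 0 (t * r)) :
    ∃ z : X, ‖z‖ ≤ t * ρ ∧ ∃ K' : Set X, IsCompact K' ∧ K' ⊆ Metric.closedBall 0 (t / 2 * r) ∧
      ∀ k ∈ K, ∃ k' ∈ K', ∃ c ∈ C, z + (k - k') = t • c := by
  obtain ⟨s, hsK, hs⟩ := hK.elim_nhds_subcover (fun x => Metric.ball x (t * r / 4))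
    (fun x _ => Metric.ball_mem_nhds x (by positivity))
  let e := s.equivFin
  obtain ⟨y, z, hz, hxy, hy⟩ := hr.2 s.card (fun j => t⁻¹ • (e.symm j : X)) (fun j => by
    have h1 := hKr (hsK _ (e.symm j).2)
    rw [mem_closedBall_zero_iff] at h1 ⊢
    rw [norm_smul, norm_inv, Real.norm_of_nonneg ht.le, inv_mul_le_iff₀ ht]
    exact h1) (r / 4) (by positivity)
  have hdist : ∀ j, ‖(e.symm j : X) - t • y j‖ ≤ t * r / 4 := fun j => by
    have : (e.symm j : X) - t • y j = t • (t⁻¹ • (e.symm j : X) - y j) := by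
      rw [smul_sub, smul_inv_smul₀ ht.ne']
    rw [this, norm_smul, Real.norm_of_nonneg ht.le]
    nlinarith [hxy j]
  refine ⟨t • z, ?_, ⋃ j, (fun x => x - t • y j) ''
    (K ∩ Metric.closedBall (e.symm j : X) (t * r / 4)), ?_, ?_, ?_⟩
  · rw [norm_smul, Real.norm_of_nonneg ht.le]
    exact mul_le_mul_of_nonneg_left (by simpa using hz) ht.le
  · exact isCompact_iUnion fun j =>
      (hK.inter_right Metric.isClosed_closedBall).image (by fun_prop)
  · refine iUnion_subset fun j => ?_
    rintro _ ⟨x, ⟨-, hx⟩, rfl⟩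
    rw [mem_closedBall_iff_norm] at hx
    rw [mem_closedBall_zero_iff]
    have := norm_add_le (x - (e.symm j : X)) ((e.symm j : X) - t • y j)
    rw [sub_add_sub_cancel] at this
    linarith [hdist j]
  · intro k hk
    obtain ⟨x, hx, hkx⟩ := mem_iUnion₂.1 (hs hk)
    refine ⟨k - t • y (e ⟨x, hx⟩), mem_iUnion.2 ⟨e ⟨x, hx⟩, k, ⟨hk, ?_⟩, rfl⟩,
      z + y (e ⟨x, hx⟩), hy _, ?_⟩
    · simpa using (Metric.mem_ball.1 hkx).le
    · simp [smul_add]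

theorem Convex.sum_geometric_add_mem {C : Set X} (hC : Convex ℝ C) {c : ℕ → X}
    (hc : ∀ i, c i ∈ C) (N : ℕ) {d : X} (hd : d ∈ C) :
    ∑ i ∈ Finset.range N, ((1 / 2 : ℝ) ^ (i + 1)) • c i + ((1 / 2 : ℝ) ^ N) • d ∈ C := by
  induction N generalizing d with
  | zero => simpa using hd
  | succ N ih =>
    have := ih (hC (hc N) hd (a := 1 / 2) (b := 1 / 2) (by norm_num) (by norm_num) (by norm_num))
    rw [Finset.sum_range_succ]
    convert this using 1
    rw [smul_add, smul_smul, smul_smul, ← pow_succ]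
    abel

/-- A bounded closed convex set with a positive loose radius `r` contains a translate of every
compact subset of `(r / 2) B_X`. -/
theorem exists_translate_subset_of_mem_looseRadii [CompleteSpace X] {C : Set X}
    (hC : IsClosed C) (hconv : Convex ℝ C) {ρ r : ℝ} (hr : r ∈ looseRadii C ρ)
    (hr0 : 0 < r) {K : Set X} (hK : IsCompact K) (hKr : K ⊆ Metric.closedBall 0 (1 / 2 * r)) :
    ∃ z : X, ∀ k ∈ K, z + k ∈ C := by
  -- The weights sum to `1`, so adding the steps gives `z + k = ∑ t i • c i` with all `c i ∈ C`. The
  -- translations `z i` depend only on the compact sets `𝓚 i`, hence a single `z` serves every `k`.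
  let t : ℕ → ℝ := fun i => (1 / 2) ^ (i + 1)
  let 𝒦 : ℕ → Type _ := fun i => {K : Set X // IsCompact K ∧ K ⊆ Metric.closedBall 0 (t i * r)}
  have step : ∀ (i : ℕ) (K : 𝒦 i), ∃ z : X, ‖z‖ ≤ t i * ρ ∧ ∃ K' : 𝒦 (i + 1),
      ∀ k : K.1, ∃ k' : K'.1, ∃ c ∈ C, z + ((k : X) - k') = t i • c := by
    rintro i ⟨K, hK, hKr⟩
    obtain ⟨z, hz, K', hK', hKr', h⟩ :=
      exists_compact_remainder hr hr0 (show 0 < t i by positivity) hK hKr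
    refine ⟨z, hz, ⟨K', hK', ?_⟩, fun k => ?_⟩
    · rwa [show t (i + 1) = t i / 2 by simp only [t]; ring]
    · obtain ⟨k', hk', c, hc, e⟩ := h k k.2
      exact ⟨⟨k', hk'⟩, c, hc, e⟩
  choose z hz K' hK' using step
  let 𝓚 : ∀ i, 𝒦 i := fun i => Nat.rec ⟨K, hK, by simpa [t] using hKr⟩ (fun i L => K' i L) i
  have ht : Tendsto (fun i : ℕ => (1 / 2 : ℝ) ^ i) atTop (𝓝 0) :=
    tendsto_pow_atTop_nhds_zero_of_lt_one (by norm_num) (by norm_num)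
  have htsum : Summable t :=
    (summable_nat_add_iff 1).2 (summable_geometric_of_lt_one (by norm_num) (by norm_num))
  have hzsum : Summable fun i => z i (𝓚 i) :=
    Summable.of_norm_bounded (htsum.mul_right ρ) fun i => hz i (𝓚 i)
  refine ⟨∑' i, z i (𝓚 i), fun k hk => ?_⟩
  choose k' c hcC hc using fun i => hK' i (𝓚 i)
  let κ : ∀ i, (𝓚 i).1 := fun i => Nat.rec ⟨k, hk⟩ (fun i x => k' i x) i
  have hκ : ∀ i, z i (𝓚 i) + ((κ i).1 - (κ (i + 1)).1) = t i • c i (κ i) := fun i => hc i (κ i)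
  have hκ0 : Tendsto (fun i => (κ i).1) atTop (𝓝 0) := by
    refine squeeze_zero_norm (a := fun i => t i * r)
      (fun i => by simpa using (𝓚 i).2.2 (κ i).2) ?_
    simpa using htsum.tendsto_atTop_zero.mul_const r
  have hsum : ∀ N, ∑ i ∈ Finset.range N, t i • c i (κ i) =
      ∑ i ∈ Finset.range N, z i (𝓚 i) + (k - (κ N).1) := fun N => by
    rw [← Finset.sum_congr rfl fun i _ => hκ i, Finset.sum_add_distrib,
      Finset.sum_range_sub' (fun i => (κ i).1)]
    rfl
  -- The missing weight `(1 / 2) ^ N` is put on `c 0`, making each partial sum a convex combination;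
  -- this term vanishes in the limit.
  refine hC.mem_of_tendsto (b := atTop) ?_ (Eventually.of_forall fun N =>
    hconv.sum_geometric_add_mem (c := fun i => c i (κ i)) (fun i => hcC i (κ i)) N
      (hcC 0 (κ 0)))
  have h1 := (hzsum.hasSum.tendsto_sum_nat.add ((tendsto_const_nhds (x := k)).sub hκ0)).add
    (ht.smul_const (c 0 (κ 0)))
  simp only [sub_zero, zero_smul, add_zero] at h1
  exact h1.congr fun N => by rw [← hsum N]

theorem not_isHaarNull_of_mem_looseRadii [CompleteSpace X] [TopologicalSpace.SeparableSpace X]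
    [MeasurableSpace X] [BorelSpace X] {C : Set X} (hC : IsClosed C) (hconv : Convex ℝ C)
    {ρ r : ℝ} (hr : r ∈ looseRadii C ρ) (hr0 : 0 < r) : ¬ IsHaarNull C := by
  rintro ⟨-, μ, hμ, h⟩
  obtain ⟨D, hDc, hD⟩ := TopologicalSpace.exists_countable_dense X
  have hcover : (⋃ a ∈ D, Metric.closedBall a (1 / 2 * r)) = univ := by
    refine eq_univ_of_forall fun x => ?_
    obtain ⟨a, ha, hxa⟩ := hD.exists_dist_lt x (show 0 < 1 / 2 * r by positivity)
    exact mem_iUnion₂.2 ⟨a, ha, hxa.le⟩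
  obtain ⟨a, ha⟩ : ∃ a, 0 < μ (Metric.closedBall a (1 / 2 * r)) := by
    by_contra! hcon
    have h0 : μ univ = 0 := by
      rw [← hcover, measure_biUnion_null_iff hDc]
      exact fun a _ => nonpos_iff_eq_zero.1 (hcon a)
    simp at h0
  have : SecondCountableTopology X := UniformSpace.secondCountable_of_separable X
  -- Finite Borel measures on a complete separable space are inner regular for compact sets.
  obtain ⟨K, hKa, hK, hK0⟩ :=
    Metric.isClosed_closedBall.measurableSet.exists_lt_isCompact_of_ne_top (measure_ne_top μ _) ha
  obtain ⟨z, hz⟩ := exists_translate_subset_of_mem_looseRadii hC hconv hr hr0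
    (K := (fun x => x - a) '' K) (hK.image (by fun_prop)) (by
      rintro _ ⟨x, hx, rfl⟩
      simpa [dist_eq_norm] using hKa hx)
  refine (hK0.trans_le (measure_mono fun x hx => ?_)).ne' (h (a - z))
  rw [mem_vadd_set_iff_neg_vadd_mem, vadd_eq_add]
  rw [show -(a - z) + x = z + (x - a) by abel]
  exact hz _ ⟨x, hx, rfl⟩

end Compact

/-! ### From probabilistic hitting to a loose radius -/

section Minimax

/-- If every averaging functional is at least `c` somewhere on the finite set `S`, then some point
of the convex hull of `S` has all coordinates at least `c`. -/
theorem exists_mem_convexHull_forall_le {ι : Type*} [Fintype ι] [DecidableEq ι]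
    {S : Set (ι → ℝ)} (hS : S.Finite) {c : ℝ}
    (h : ∀ w : ι → ℝ, (∀ i, 0 ≤ w i) → ∑ i, w i = 1 → ∃ s ∈ S, c ≤ ∑ i, w i * s i)
    (hne : S.Nonempty) : ∃ t ∈ convexHull ℝ S, ∀ i, c ≤ t i := by
  by_contra! hcon
  have hT : IsClosed {t : ι → ℝ | ∀ i, c ≤ t i} := by
    simp only [ofPred_forall]
    exact isClosed_iInter fun i => isClosed_le continuous_const (continuous_apply i)
  have hTc : Convex ℝ {t : ι → ℝ | ∀ i, c ≤ t i} := by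
    intro x hx y hy a b ha hb hab i
    have h1 := mul_le_mul_of_nonneg_left (hx i) ha
    have h2 := mul_le_mul_of_nonneg_left (hy i) hb
    simp only [Pi.add_apply, Pi.smul_apply, smul_eq_mul]
    calc c = a * c + b * c := by rw [← add_mul, hab, one_mul]
      _ ≤ _ := add_le_add h1 h2
  obtain ⟨f, u, v, hfu, huv, hfv⟩ := geometric_hahn_banach_compact_closed (convex_convexHull ℝ S)
    (hS.isCompact_convexHull ℝ) hTc hT (by
      rw [Set.disjoint_left]
      intro t ht ht'
      obtain ⟨i, hi⟩ := hcon t ht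
      exact absurd (ht' i) (not_le.2 hi))
  let φ : ι → ℝ := fun i => f (Pi.single i 1)
  have hf : ∀ x, f x = ∑ i, φ i * x i := fun x => by
    conv_lhs => rw [pi_eq_sum_univ' x]
    simp [φ, mul_comm]
  -- The orthant above `c` is stable under adding positive multiples of basis vectors, while `f` is
  -- bounded below on it. After normalisation `φ` is thus an averaging functional, to which `h`
  -- applies.
  have hφ : ∀ i, 0 ≤ φ i := fun i => by
    by_contra! hneg
    obtain ⟨m, hm⟩ := exists_nat_gt ((f (fun _ => c) - v) / (-φ i))
    have h1 := hfv ((fun _ => c) + (m : ℝ) • Pi.single i 1) (fun j => by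
      simp only [Pi.add_apply, Pi.smul_apply, smul_eq_mul, le_add_iff_nonneg_right]
      refine mul_nonneg m.cast_nonneg ?_
      by_cases hij : j = i
      · subst hij; simp
      · simp [hij])
    rw [map_add, map_smul, smul_eq_mul] at h1
    rw [div_lt_iff₀ (by linarith)] at hm
    simp only [φ] at hm
    linarith
  have hW : 0 < ∑ i, φ i := by
    refine (Finset.sum_nonneg fun i _ => hφ i).lt_of_ne fun h0 => ?_
    have hz : ∀ i, φ i = 0 := fun i =>
      (Finset.sum_eq_zero_iff_of_nonneg fun i _ => hφ i).1 h0.symm i (Finset.mem_univ i)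
    obtain ⟨s, hs⟩ := hne
    have h1 := hfu s (subset_convexHull ℝ S hs)
    have h2 := hfv (fun _ => c) (fun _ => le_rfl)
    rw [hf] at h1 h2
    simp only [hz, zero_mul, Finset.sum_const_zero] at h1 h2
    linarith
  obtain ⟨s, hs, hcs⟩ := h (fun i => φ i / ∑ i, φ i) (fun i => div_nonneg (hφ i) hW.le)
    (by rw [← Finset.sum_div, div_self hW.ne'])
  have h1 := hfu s (subset_convexHull ℝ S hs)
  have h2 := hfv (fun _ => c) (fun _ => le_rfl)
  rw [hf] at h1 h2
  rw [← Finset.sum_mul] at h2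
  have h3 : c * ∑ i, φ i ≤ ∑ i, φ i * s i := by
    have := mul_le_mul_of_nonneg_right hcs hW.le
    rw [Finset.sum_mul] at this
    refine this.trans_eq (Finset.sum_congr rfl fun i _ => ?_)
    field_simp
  linarith

variable {X : Type*} [NormedAddCommGroup X] [NormedSpace ℝ X]

/-- The law of a random variable that vanishes with probability `1 / 2` and has weights `w / 2`
otherwise. -/
theorem exists_isProbabilityMeasure_fin_succ {n : ℕ} (w : Fin n → ℝ) (hw : ∀ i, 0 ≤ w i)
    (hw1 : ∑ i, w i = 1) :
    ∃ P : Measure (Fin (n + 1)), IsProbabilityMeasure P ∧ P.real {0} = 1 / 2 ∧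
      ∀ i, P.real {Fin.succ i} = w i / 2 := by
  let p : Fin (n + 1) → ℝ := Fin.cons (1 / 2) fun i => w i / 2
  have hp : ∀ o, 0 ≤ p o :=
    Fin.cases (by norm_num [p]) fun i => by simpa [p] using div_nonneg (hw i) zero_le_two
  have hp1 : ∑ o, p o = 1 := by
    rw [Fin.sum_univ_succ]
    simp only [p, Fin.cons_zero, Fin.cons_succ, ← Finset.sum_div, hw1]
    norm_num
  let P : Measure (Fin (n + 1)) := ∑ o, ENNReal.ofReal (p o) • Measure.dirac o
  have hP : ∀ o, P.real {o} = p o := fun o => by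
    simp only [P, measureReal_def, Measure.finsetSum_apply, Measure.smul_apply, smul_eq_mul]
    rw [Finset.sum_eq_single o]
    · simp [hp]
    · intro b _ hb
      simp [hb]
    · simp
  refine ⟨P, ⟨?_⟩, ?_, fun i => ?_⟩
  · simp only [P, Measure.finsetSum_apply, Measure.smul_apply, measure_univ, smul_eq_mul, mul_one]
    rw [← ENNReal.ofReal_sum_of_nonneg fun o _ => hp o, hp1, ENNReal.ofReal_one]
  · rw [hP]
    rfl
  · rw [hP]
    simp [p]

/-- If every small finitely supported random vector lies with probability more than `3 / 4` in
some translate of every neighbourhood of `C`, then `C` has a positive loose radius. -/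
theorem half_mem_looseRadii {C : Set X} (hC : Convex ℝ C) (hCb : Bornology.IsBounded C) {r : ℝ}
    (hr : 0 < r)
    (h : ∀ (n : ℕ) (P : Measure (Fin (n + 1))) (y : Fin (n + 1) → X) (ε : ℝ),
      IsProbabilityMeasure P → (∀ o, ‖y o‖ ≤ r) → 0 < ε →
      ∃ x, 3 / 4 < P.real {o | x + y o ∈ Metric.thickening ε C}) :
    ∃ ρ, r / 2 ∈ looseRadii C ρ := by
  classical
  obtain ⟨M, hM⟩ := hCb.exists_norm_le
  refine ⟨M + 1, by positivity, fun n x hx ε hε => ?_⟩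
  set δ := min ε 1 with hδ_def
  have hδ : 0 < δ := lt_min hε one_pos
  set T := Metric.thickening δ C with hT_def
  have hT : Convex ℝ T := hC.thickening δ
  let y : Fin (n + 1) → X := Fin.cons 0 fun i => (2 : ℝ) • x i
  have hy : ∀ o, ‖y o‖ ≤ r := by
    refine Fin.cases (by simpa [y] using hr.le) fun i => ?_
    · have := hx i
      rw [mem_closedBall_zero_iff] at this
      simp only [y, Fin.cons_succ, norm_smul, Real.norm_ofNat]
      linarith
  let v : X → Fin n → ℝ := fun z j => if z + y j.succ ∈ T then 1 else 0
  -- Half of the mass sits at `0`, so a probability above `3 / 4` forces `z ∈ T`; the other half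
  -- then contributes more than `1 / 4`, a `w`-average above `1 / 2`.
  have hmix : ∀ w : Fin n → ℝ, (∀ i, 0 ≤ w i) → ∑ i, w i = 1 →
      ∃ s ∈ v '' T, 1 / 2 ≤ ∑ i, w i * s i := by
    intro w hw hw1
    obtain ⟨P, hP, hP0, hPi⟩ := exists_isProbabilityMeasure_fin_succ w hw hw1
    obtain ⟨z, hz⟩ := h n P y δ hP hy hδ
    rw [← hT_def] at hz
    have hsum : P.real {o | z + y o ∈ T} =
        (if z ∈ T then 1 / 2 else 0) + ∑ i, w i / 2 * v z i := by
      have e : {o | z + y o ∈ T} = ↑(Finset.univ.filter fun o => z + y o ∈ T) := by simp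
      rw [e, ← sum_measureReal_singleton, Finset.sum_filter, Fin.sum_univ_succ]
      simp only [hP0, hPi, v, mul_ite, mul_one, mul_zero]
      simp [y]
    have hle : ∑ i, w i / 2 * v z i ≤ 1 / 2 := by
      calc ∑ i, w i / 2 * v z i ≤ ∑ i, w i / 2 := Finset.sum_le_sum fun i _ => by
            refine mul_le_of_le_one_right (div_nonneg (hw i) zero_le_two) ?_
            simp only [v]
            split_ifs <;> norm_num
        _ = 1 / 2 := by rw [← Finset.sum_div, hw1]
    rw [hsum] at hz
    have hzT : z ∈ T := by
      by_contra hzT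
      rw [if_neg hzT] at hz
      linarith
    refine ⟨v z, ⟨z, hzT, rfl⟩, ?_⟩
    rw [if_pos hzT] at hz
    have : ∑ i, w i / 2 * v z i = (∑ i, w i * v z i) / 2 := by
      rw [Finset.sum_div]
      exact Finset.sum_congr rfl fun i _ => by ring
    linarith
  have hfin : (v '' T).Finite := by
    refine (Set.Finite.pi' (t := fun _ : Fin n => ({0, 1} : Set ℝ)) fun _ => by simp).subset ?_
    rintro _ ⟨z, -, rfl⟩ j
    simp only [v]
    split_ifs <;> simp
  obtain ⟨z, hzT, hz⟩ : ∃ z ∈ T, ∀ j, z + x j ∈ T := by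
    obtain ⟨x₀, hx₀⟩ := h n (Measure.dirac 0) (fun _ => 0) δ inferInstance (by simp [hr.le]) hδ
    have hTne : T.Nonempty := by
      by_contra hne
      rw [not_nonempty_iff_eq_empty] at hne
      rw [← hT_def, hne] at hx₀
      norm_num at hx₀
    obtain ⟨t, ht, hct⟩ := exists_mem_convexHull_forall_le hfin hmix (hTne.image v)
    -- Convexity of `T` turns mixtures of indicator vectors into scalings of the `y j.succ`. A point
    -- with all `t j ≥ 1 / 2` reaches at least `x j = y j.succ / 2`, and contracting towards `z ∈ T`
    -- gives `z + x j ∈ T`.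
    let G : Set (Fin n → ℝ) := {t | ∃ z ∈ T, ∀ j, z + t j • y j.succ ∈ T}
    have hG : Convex ℝ G := by
      rintro s ⟨z, hz, hs⟩ s' ⟨z', hz', hs'⟩ a b ha hb hab
      refine ⟨a • z + b • z', hT hz hz' ha hb hab, fun j => ?_⟩
      convert hT (hs j) (hs' j) ha hb hab using 1
      simp only [Pi.add_apply, Pi.smul_apply, smul_eq_mul]
      module
    have hvG : v '' T ⊆ G := by
      rintro _ ⟨z, hz, rfl⟩
      refine ⟨z, hz, fun j => ?_⟩
      simp only [v]
      split_ifs with hj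
      · simpa using hj
      · simpa using hz
    obtain ⟨z, hz, htz⟩ := convexHull_min hvG hG ht
    refine ⟨z, hz, fun j => ?_⟩
    have htj : 0 < t j := by linarith [hct j]
    have h1 : 1 / (2 * t j) ≤ 1 := by
      rw [div_le_one (by positivity)]
      linarith [hct j]
    convert hT hz (htz j) (a := 1 - 1 / (2 * t j)) (b := 1 / (2 * t j)) (by linarith)
      (by positivity) (by ring) using 1
    have : (1 / (2 * t j)) • t j • y j.succ = x j := by
      simp only [y, Fin.cons_succ, smul_smul]
      rw [show 1 / (2 * t j) * (t j * 2) = 1 by field_simp, one_smul]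
    rw [smul_add, this]
    module
  choose c hc hzc using fun j => Metric.mem_thickening_iff.1 (hz j)
  refine ⟨fun j => c j - z, z, ?_, fun j => ?_, fun j => by simpa using hc j⟩
  · obtain ⟨c₀, hc₀, hzc₀⟩ := Metric.mem_thickening_iff.1 hzT
    rw [dist_eq_norm] at hzc₀
    rw [mem_closedBall_zero_iff]
    have h1 := norm_add_le (z - c₀) c₀
    rw [sub_add_cancel] at h1
    linarith [hM c₀ hc₀, min_le_right ε 1]
  · have h1 := (hzc j).trans_le (min_le_left ε 1)
    rw [dist_eq_norm] at h1
    rwa [show x j - (c j - z) = z + x j - c j by abel]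

end Minimax

/-! ### Haar null sets from independent random series -/

section RandomSeries

variable {X : Type*} [NormedAddCommGroup X]

theorem norm_sum_Ico_le {Y : ℕ → X} {r : ℕ → ℝ} (hY : ∀ k, ‖Y k‖ ≤ r k)
    (hr : ∀ k, r (k + 1) ≤ r k / 2) {k m : ℕ} (hkm : k ≤ m) :
    ‖∑ j ∈ Finset.Ico k m, Y j‖ ≤ 2 * r k - 2 * r m := by
  induction m, hkm using Nat.le_induction with
  | base => simp
  | succ m hkm ih =>
    rw [Finset.sum_Ico_succ_top hkm]
    linarith [norm_add_le (∑ j ∈ Finset.Ico k m, Y j) (Y m), hY m, hr m]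

variable [MeasurableSpace X] [BorelSpace X] [SecondCountableTopology X]

/-- Fubini over the law of `Y`: the inner probability is at most `s`, and it is zero unless `x + Y ω
∈ V`. -/
theorem measure_add_add_mem_le_of_indepFun {Ω : Type*} [MeasurableSpace Ω] {P : Measure Ω}
    [IsProbabilityMeasure P] {Y T : Ω → X} (hY : Measurable Y) (hT : Measurable T)
    (hYT : ProbabilityTheory.IndepFun Y T P) {U V : Set X} (hU : MeasurableSet U)
    (hV : MeasurableSet V) {x : X} {q s : ℝ≥0∞} (hq : P {ω | x + Y ω ∈ V} ≤ q)
    (hs : ∀ x, P {ω | x + T ω ∈ U} ≤ s) (hUV : ∀ ω ω', x + Y ω + T ω' ∈ U → x + Y ω ∈ V) :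
    P {ω | x + Y ω + T ω ∈ U} ≤ q * s := by
  have hmeas : MeasurableSet {p : X × X | x + p.1 + p.2 ∈ U} :=
    hU.preimage (by fun_prop)
  have hVm : MeasurableSet {y | x + y ∈ V} := hV.preimage (by fun_prop)
  have e : P {ω | x + Y ω + T ω ∈ U} =
      ((P.map Y).prod (P.map T)) {p : X × X | x + p.1 + p.2 ∈ U} := by
    rw [← (ProbabilityTheory.indepFun_iff_map_prod_eq_prod_map_map hY.aemeasurable
      hT.aemeasurable).1 hYT, Measure.map_apply (hY.prodMk hT) hmeas]
    rfl
  rw [e, Measure.prod_apply hmeas, lintegral_map (measurable_measure_prodMk_left hmeas) hY]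
  calc ∫⁻ ω, (P.map T) (Prod.mk (Y ω) ⁻¹' {p : X × X | x + p.1 + p.2 ∈ U}) ∂P
      ≤ ∫⁻ ω, {ω | x + Y ω ∈ V}.indicator (fun _ => s) ω ∂P := by
        refine lintegral_mono fun ω => ?_
        rw [Measure.map_apply hT (hmeas.preimage (by fun_prop))]
        by_cases hω : x + Y ω ∈ V
        · rw [indicator_of_mem (by exact hω)]
          exact hs (x + Y ω)
        · rw [indicator_of_notMem (by exact hω), nonpos_iff_eq_zero]
          convert measure_empty (μ := P)
          exact eq_empty_of_forall_notMem fun ω' h => hω (hUV ω ω' h)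
    _ = s * P {ω | x + Y ω ∈ V} := lintegral_indicator_const (hVm.preimage hY) s
    _ ≤ q * s := by
        rw [mul_comm]
        gcongr

variable {Ω : Type*} [MeasurableSpace Ω] {P : Measure Ω} [IsProbabilityMeasure P]

/-- Each summand costs a factor `q`. The terms after `k` have total norm at most `2 * r (k + 1) - 2
* r m`; with the thickening `4 * r m` this is at most `4 * r (k + 1) ≤ ε k`. Hence the full sum can
land near `C` only if `x + Y k` is already `ε k`-close to it. -/
theorem measure_add_sum_mem_thickening_le {C : Set X} {Y : ℕ → Ω → X}
    (hYm : ∀ k, Measurable (Y k)) (hYi : ProbabilityTheory.iIndepFun Y P) {r ε : ℕ → ℝ}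
    (hr0 : ∀ k, 0 < r k) (hY : ∀ k ω, ‖Y k ω‖ ≤ r k) (hr : ∀ k, r (k + 1) ≤ r k / 2)
    (hε : ∀ k, 4 * r (k + 1) ≤ ε k) {q : ℝ≥0∞}
    (hq : ∀ k x, P {ω | x + Y k ω ∈ Metric.thickening (ε k) C} ≤ q) {m : ℕ} (n : ℕ) :
    ∀ k, k + n = m → ∀ x, P {ω | x + ∑ j ∈ Finset.Ico k m, Y j ω ∈
      Metric.thickening (4 * r m) C} ≤ q ^ n := by
  induction n with
  | zero => exact fun k _ x => by simpa using prob_le_one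
  | succ n ih =>
    intro k hk x
    have hkm : k < m := by omega
    have hind : ProbabilityTheory.IndepFun (Y k) (∑ j ∈ Finset.Ico (k + 1) m, Y j) P :=
      (hYi.indepFun_finsetSum_of_notMem hYm (by simp)).symm
    have hTm : Measurable (∑ j ∈ Finset.Ico (k + 1) m, Y j) := by
      rw [Finset.sum_fn]
      exact Finset.measurable_fun_sum _ fun j _ => hYm j
    have hmono : r m ≤ r (k + 1) :=
      antitone_nat_of_succ_le (fun k => by linarith [hr k, hr0 k]) (by omega)
    have := measure_add_add_mem_le_of_indepFun (hYm k) hTm hind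
      (U := Metric.thickening (4 * r m) C) (V := Metric.thickening (ε k) C)
      Metric.isOpen_thickening.measurableSet Metric.isOpen_thickening.measurableSet
      (x := x) (hq k x) (s := q ^ n) (fun x => by
        simpa only [Finset.sum_apply] using ih (k + 1) (by omega) x) (by
        intro ω ω' h
        obtain ⟨c, hc, hxc⟩ := Metric.mem_thickening_iff.1 h
        refine Metric.mem_thickening_iff.2 ⟨c, hc, ?_⟩
        have h1 := norm_sum_Ico_le (Y := fun j => Y j ω') (fun j => hY j ω') hr
          (show k + 1 ≤ m by omega)
        rw [Finset.sum_apply] at hxc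
        have h2 := dist_triangle (x + Y k ω)
          (x + Y k ω + ∑ j ∈ Finset.Ico (k + 1) m, Y j ω') c
        rw [dist_self_add_right] at h2
        linarith [hε k])
    rw [pow_succ']
    convert this using 5
    rw [Finset.sum_eq_sum_Ico_succ_bot hkm, Finset.sum_apply, add_assoc]

theorem isHaarNull_of_iIndepFun [CompleteSpace X] {C : Set X} (hC : IsClosed C) {Y : ℕ → Ω → X}
    (hYm : ∀ k, Measurable (Y k)) (hYi : ProbabilityTheory.iIndepFun Y P) {r ε : ℕ → ℝ}
    (hr0 : ∀ k, 0 < r k) (hY : ∀ k ω, ‖Y k ω‖ ≤ r k) (hr : ∀ k, r (k + 1) ≤ r k / 2)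
    (hε : ∀ k, 4 * r (k + 1) ≤ ε k) {q : ℝ≥0∞} (hq1 : q < 1)
    (hq : ∀ k x, P {ω | x + Y k ω ∈ Metric.thickening (ε k) C} ≤ q) : IsHaarNull C := by
  have hgeom : ∀ k, r k ≤ r 0 * (1 / 2) ^ k := fun k => by
    induction k with
    | zero => simp
    | succ k ih => rw [pow_succ]; linarith [hr k]
  have hsum : ∀ ω, Summable fun k => Y k ω := fun ω =>
    Summable.of_norm_bounded
      ((summable_geometric_of_lt_one (by norm_num) (by norm_num)).mul_left (r 0))
      fun k => (hY k ω).trans (hgeom k)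
  let T : Ω → X := fun ω => ∑' k, Y k ω
  have hlim : ∀ ω, Tendsto (fun m => ∑ j ∈ Finset.range m, Y j ω) atTop (𝓝 (T ω)) :=
    fun ω => (hsum ω).hasSum.tendsto_sum_nat
  have hT : Measurable T := measurable_of_tendsto_metrizable
    (f := fun m ω => ∑ j ∈ Finset.range m, Y j ω)
    (fun m => Finset.measurable_fun_sum _ fun j _ => hYm j) (tendsto_pi_nhds.2 hlim)
  have htail : ∀ ω m, ‖T ω - ∑ j ∈ Finset.range m, Y j ω‖ ≤ 2 * r m := fun ω m => by
    refine le_of_tendsto (((hlim ω).sub_const _).norm) ?_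
    filter_upwards [eventually_ge_atTop m] with M hM
    rw [← Finset.sum_Ico_eq_sub _ hM]
    linarith [norm_sum_Ico_le (Y := fun j => Y j ω) (fun j => hY j ω) hr hM, hr0 M]
  -- If `x + T ω ∈ C`, the `m`-th partial sum is within `2 * r m < 4 * r m` of `C`.
  have hbound : ∀ x m, P {ω | x + T ω ∈ C} ≤ q ^ m := fun x m => by
    refine le_trans (measure_mono fun ω hω => ?_)
      (measure_add_sum_mem_thickening_le hYm hYi hr0 hY hr hε hq m 0 (zero_add m) x)
    refine Metric.mem_thickening_iff.2 ⟨_, hω, ?_⟩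
    rw [dist_add_left, dist_comm, dist_eq_norm, ← Finset.range_eq_Ico]
    linarith [htail ω m, hr0 m]
  refine ⟨hC.measurableSet, P.map T, Measure.isProbabilityMeasure_map hT.aemeasurable,
    fun x => ?_⟩
  have hpre : T ⁻¹' (x +ᵥ C) = {ω | -x + T ω ∈ C} := by
    ext ω
    rw [mem_preimage, mem_vadd_set_iff_neg_vadd_mem, vadd_eq_add]
    rfl
  rw [Measure.map_apply hT (hC.vadd x).measurableSet, hpre, ← nonpos_iff_eq_zero]
  exact ge_of_tendsto' (ENNReal.tendsto_pow_atTop_nhds_zero_of_lt_one hq1) (hbound (-x))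

variable [NormedSpace ℝ X]

/-- A bounded closed convex set that is not Haar null has a positive loose radius. -/
theorem exists_mem_looseRadii_of_not_isHaarNull [CompleteSpace X] {C : Set X} (hC : IsClosed C)
    (hconv : Convex ℝ C) (hb : Bornology.IsBounded C) (h : ¬ IsHaarNull C) :
    ∃ ρ r, 0 < r ∧ r ∈ looseRadii C ρ := by
  by_contra! hcon
  have hbad : ∀ r : Ioi (0 : ℝ), ∃ (n : ℕ) (P : Measure (Fin (n + 1)))
      (y : Fin (n + 1) → X) (ε : ℝ), IsProbabilityMeasure P ∧ (∀ o, ‖y o‖ ≤ r) ∧ 0 < ε ∧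
      ∀ x, P.real {o | x + y o ∈ Metric.thickening ε C} ≤ 3 / 4 := by
    intro r
    by_contra! hr
    obtain ⟨ρ, hρ⟩ := half_mem_looseRadii hconv hb (mem_Ioi.1 r.2) fun n P y ε hP hy hε =>
      hr n P y ε hP hy hε
    exact hcon ρ _ (half_pos (mem_Ioi.1 r.2)) hρ
  choose n P y ε hP hy hε hPC using hbad
  -- The next radius is chosen after the neighbourhood size `ε` belonging to the current one, so
  -- that all later terms together cannot leave that neighbourhood.
  let r : ℕ → Ioi (0 : ℝ) := fun k => Nat.rec ⟨1, mem_Ioi.2 one_pos⟩ (fun _ s =>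
    ⟨min (s.1 / 2) (ε s / 4), mem_Ioi.2 (lt_min (half_pos s.2) (by linarith [hε s]))⟩) k
  have hr : ∀ k : ℕ, (r (k + 1)).1 = min ((r k).1 / 2) (ε (r k) / 4) := fun k => rfl
  refine h (isHaarNull_of_iIndepFun (P := Measure.infinitePi fun k => P (r k)) hC
    (Y := fun k ω => y (r k) (ω k)) (r := fun k => (r k).1) (ε := fun k => ε (r k))
    (q := ENNReal.ofReal (3 / 4)) (fun k => (measurable_of_finite _).comp (measurable_pi_apply k))
    (ProbabilityTheory.iIndepFun_infinitePi fun k => measurable_of_finite (y (r k)))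
    (fun k => (r k).2) (fun k ω => hy _ _) (fun k => (hr k).trans_le (min_le_left _ _))
    (fun k => ?_) ?_ fun k x => ?_)
  · linarith [(hr k).trans_le (min_le_right _ _)]
  · rw [← ENNReal.ofReal_one]
    exact (ENNReal.ofReal_lt_ofReal_iff one_pos).2 (by norm_num)
  · have h1 := hPC (r k) x
    rw [measureReal_def, ← ENNReal.le_ofReal_iff_toReal_le (measure_ne_top _ _) (by norm_num)] at h1
    refine le_trans (le_of_eq ?_) h1
    conv_rhs => rw [← Measure.infinitePi_map_eval (fun k => P (r k)) k]
    rw [Measure.map_apply (measurable_pi_apply k) (Set.toFinite _).measurableSet]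
    rfl

end RandomSeries

/-! ### The main theorem -/

theorem mainTheorem2 {X : Type*} [NormedAddCommGroup X] [NormedSpace ℝ X] [CompleteSpace X]
    [MeasurableSpace X] [BorelSpace X] :
    LipschitzWith 1 (fun C : ClosedConvexBounded X => boundedLooseRadius (C : Set X)) ∧
    (TopologicalSpace.SeparableSpace X →
      IsOpen {C : ClosedConvexBounded X | IsHaarPositive (C : Set X)} ∧
      ∀ (C : ℕ → ClosedConvexBounded X) (L : ClosedConvexBounded X),
        Tendsto C atTop (𝓝 L) → (∀ n, IsHaarNull (C n : Set X)) → IsHaarNull (L : Set X)) := by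
  refine ⟨ClosedConvexBounded.lipschitzWith_boundedLooseRadius, fun hX => ?_⟩
  have : SecondCountableTopology X := UniformSpace.secondCountable_of_separable X
  have hopen : IsOpen {C : ClosedConvexBounded X | IsHaarPositive (C : Set X)} := by
    rw [Metric.isOpen_iff]
    rintro C ⟨-, hC⟩
    obtain ⟨ρ, r, hr0, hr⟩ :=
      exists_mem_looseRadii_of_not_isHaarNull C.isClosed C.convex C.isBounded hC
    -- Within distance `r / 2` of `C` the radius `r - r / 2 > 0` survives.
    refine ⟨r / 2, half_pos hr0, fun D hD => ⟨D.isClosed.measurableSet, ?_⟩⟩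
    rw [Metric.mem_ball, dist_comm] at hD
    exact not_isHaarNull_of_mem_looseRadii D.isClosed D.convex
      (sub_mem_looseRadii D.convex (half_pos hr0).le
        (ClosedConvexBounded.exists_norm_sub_le hD) hr (by linarith)) (by linarith)
  refine ⟨hopen, fun C L hCL hnull => ?_⟩
  by_contra hL
  obtain ⟨n, hn⟩ :=
    (hCL.eventually (hopen.mem_nhds (show IsHaarPositive (L : Set X) from
      ⟨L.isClosed.measurableSet, hL⟩))).exists
  exact hn.2 (hnull n)
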